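/- \textbf{Setting.} A MILP instance is $\min_{x\in\mathbb{R}^n} c^Tx$ subject to $Ax\le b$, $l\le x\le u$, $x_1,\dots,x_r\in\mathbb{Z}$, with $A\in\mathbb{R}^{m\times n}$, $b\in\mathbb{R}^m$, $c\in\mathbb{R}^n$, $l\in(\mathbb{R}\cup\{-\infty\})^n$, $u\in(\mathbb{R}\cup\{+\infty\})^n$, $0\le r\le n$. Its bipartite graph representation $G=(V,W,A,F_V,F_W)$ has constraint nodes $V=\{1,\dots,m\}$ with features $F_i=b_i$, variable nodes $W=\{1,\dots,n\}$ with features $F_j=(c_j,l_j,u_j,1_{j\le r})$, and an edge $(i,j)$ of weight $A_{ij}$ whenever $A_{ij}\neq 0$; $\mathcal{N}_W(i)$ and $\mathcal{N}_V(j)$ denote the sets of neighbours. The LP relaxation drops the integrality constraints; the optimal value of an LP is $+\infty$ if it is infeasible and $-\infty$ if its objective is unbounded below. \textbf{Strong branching.} Let $x^*$ be the optimal solution of the LP relaxation, assumed to exist (if there are several, the one of least Euclidean norm). The candidate variables are those $x_j$ with $j\le r$ and $x_j^*\notin\mathbb{Z}$; an instance whose LP relaxation has no optimal solution has no candidates.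 For a candidate $j$, let $\Delta_j^+$ (respectively $\Delta_j^-$) be the optimal value of the LP relaxation with the additional constraint $x_j\ge\lceil x_j^*\rceil$ (respectively $x_j\le\lfloor x_j^*\rfloor$) minus the optimal value of the LP relaxation, so $\Delta_j^\pm\in[0,+\infty]$. The strong branching score is $\mathrm{score}(j)=f(\Delta_j^+,\Delta_j^-)$, where $f$ is a function with values in $[-\infty,\infty]$, defined for extended real arguments and continuous on $[0,\infty)^2$. \textbf{Subgraph GNNs.} A (node-anchored) Subgraph GNN with $L\ge 0$ update layers is given by continuous functions $\{p^l,q^l\}_{l=0}^L$, $\{f^l,g^l\}_{l=1}^L$ and $r$ between finite-dimensional real feature spaces (infinite bounds being inputs in $[-\infty,\infty]$ with its usual topology), with $r$ real-valued. For each anchor $j'\in W$ and all $i\in V$, $j\in W$, it computes $$s^0_{ij'}=p^0(F_i,F_{j'}),\qquad t^0_{jj'}=q^0(F_j,F_{j'},1_{j=j'}),$$ $$s^l_{ij'}=p^l\Big(s^{l-1}_{ij'},\sum_{j\in\mathcal{N}_W(i)}f^l(t^{l-1}_{jj'},A_{ij})\Big),\qquad t^l_{jj'}=q^l\Big(t^{l-1}_{jj'},\sum_{i\in\mathcal{N}_V(j)}g^l(s^{l-1}_{ij'},A_{ij})\Big)\qquad(1\le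 l\le L),$$ and outputs $y_{j'}(G)=r\big(\sum_{i\in V}s^L_{ij'},\sum_{j\in W}t^L_{jj'}\big)$. \textbf{Theorem.} Let $\mathcal{D}$ be a finite dataset of bipartite graph representations of MILP instances (of possibly different sizes), and assume that for every $G\in\mathcal{D}$ and every candidate variable $j$ of $G$, $\mathrm{score}(j)$ is finite. Then for every $\delta>0$ there exists a Subgraph GNN such that $$|y_j(G)-\mathrm{score}(j)|<\delta\qquad\text{for all }G\in\mathcal{D}\text{ and all candidate variables }j\text{ of }G.$$ -/

import Mathlib

/-- A mixed-integer linear program in standard form: minimise `c ⬝ x` subject to `A x ≤ b` and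
`l ≤ x ≤ u`, the first `r` of the `n` variables being integral. -/
structure MILP where
  /-- number of constraints -/
  m : ℕ
  /-- number of variables -/
  n : ℕ
  /-- number of integral variables -/
  r : ℕ
  r_le : r ≤ n
  A : Matrix (Fin m) (Fin n) ℝ
  b : Fin m → ℝ
  c : Fin n → ℝ
  l : Fin n → EReal
  u : Fin n → EReal
  l_ne_top : ∀ j, l j ≠ ⊤
  u_ne_bot : ∀ j, u j ≠ ⊥

/-- The space of features `(c_j, l_j, u_j, 1_{j ≤ r})` of variable nodes. -/
abbrev VarFeature : Type := ℝ × EReal × EReal × ℝ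

/-- Weighted bipartite graphs with constraint nodes `Fin m`, variable nodes `Fin n`, an edge
`(i, j)` of weight `A i j` for every nonzero entry of `A`, and node features. -/
structure BipartiteGraph where
  m : ℕ
  n : ℕ
  A : Matrix (Fin m) (Fin n) ℝ
  FV : Fin m → ℝ
  FW : Fin n → VarFeature

namespace BipartiteGraph

open Classical in
/-- The neighbours (variable nodes) of a constraint node. -/
noncomputable def nbrW (G : BipartiteGraph) (i : Fin G.m) : Finset (Fin G.n) :=
  Finset.univ.filter fun j => G.A i j ≠ 0

open Classical in
/-- The neighbours (constraint nodes) of a variable node. -/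
noncomputable def nbrV (G : BipartiteGraph) (j : Fin G.n) : Finset (Fin G.m) :=
  Finset.univ.filter fun i => G.A i j ≠ 0

end BipartiteGraph

namespace MILP

/-- The bipartite graph representation of a MILP. -/
noncomputable def graph (P : MILP) : BipartiteGraph where
  m := P.m
  n := P.n
  A := P.A
  FV := P.b
  FW := fun j => (P.c j, P.l j, P.u j, if (j : ℕ) < P.r then 1 else 0)

/-- The objective function. -/
def obj (P : MILP) (x : Fin P.n → ℝ) : ℝ := ∑ j, P.c j * x j

/-- The feasible set of the LP relaxation. -/
def lpFeasible (P : MILP) : Set (Fin P.n → ℝ) :=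
  {x | (∀ i, ∑ j, P.A i j * x j ≤ P.b i) ∧ ∀ j, P.l j ≤ (x j : EReal) ∧ (x j : EReal) ≤ P.u j}

/-- The optimal objective value over the set `S`: it is `+∞` if `S` is empty and `-∞` if the
objective can be lowered arbitrarily on `S`. -/
noncomputable def optValue (P : MILP) (S : Set (Fin P.n → ℝ)) : EReal :=
  ⨅ x ∈ S, (P.obj x : EReal)

/-- `x` is an optimal solution of the LP relaxation. -/
def IsOptimal (P : MILP) (x : Fin P.n → ℝ) : Prop :=
  x ∈ P.lpFeasible ∧ ∀ y ∈ P.lpFeasible, P.obj x ≤ P.obj y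

/-- `x` is the solution of the LP relaxation: the optimal solution of least Euclidean norm
(there is at most one such `x`; if the optimal solution is unique, it is that solution). -/
def IsLPSolution (P : MILP) (x : Fin P.n → ℝ) : Prop :=
  P.IsOptimal x ∧ ∀ y, P.IsOptimal y → ∑ j, x j ^ 2 ≤ ∑ j, y j ^ 2

/-- The candidates for branching at `x`: integral variables with non-integral value in `x`. -/
def IsCandidate (P : MILP) (x : Fin P.n → ℝ) (j : Fin P.n) : Prop :=
  (j : ℕ) < P.r ∧ ∀ k : ℤ, x j ≠ (k : ℝ)

/-- `Δ_j⁺`: optimal value of the LP with the additional constraint `⌈x_j⌉ ≤ z_j`, minus the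
optimal value of the LP relaxation. -/
noncomputable def deltaPlus (P : MILP) (x : Fin P.n → ℝ) (j : Fin P.n) : EReal :=
  P.optValue {z | z ∈ P.lpFeasible ∧ (⌈x j⌉ : ℝ) ≤ z j} - P.optValue P.lpFeasible

/-- `Δ_j⁻`: optimal value of the LP with the additional constraint `z_j ≤ ⌊x_j⌋`, minus the
optimal value of the LP relaxation. -/
noncomputable def deltaMinus (P : MILP) (x : Fin P.n → ℝ) (j : Fin P.n) : EReal :=
  P.optValue {z | z ∈ P.lpFeasible ∧ z j ≤ (⌊x j⌋ : ℝ)} - P.optValue P.lpFeasible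

/-- The strong branching score of the variable `j` for the scoring function `f`. -/
noncomputable def score (P : MILP) (f : EReal → EReal → EReal) (x : Fin P.n → ℝ) (j : Fin P.n) :
    EReal :=
  f (P.deltaPlus x j) (P.deltaMinus x j)

end MILP

/-- A node-anchored subgraph GNN for bipartite graphs with `L` update layers. Its learnable
functions are continuous maps between finite-dimensional feature spaces (`ds l`, `dt l` are the
dimensions of the features `s^l`, `t^l`, and `df l`, `dg l` those of the messages). The update
from layer `l` to layer `l + 1` uses `p l`, `q l`, `f l`, `g l`; only those with `l < L` matter. -/
structure SubgraphGNN where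
  L : ℕ
  ds : ℕ → ℕ
  dt : ℕ → ℕ
  df : ℕ → ℕ
  dg : ℕ → ℕ
  p0 : C(ℝ × VarFeature, Fin (ds 0) → ℝ)
  q0 : C(VarFeature × VarFeature × ℝ, Fin (dt 0) → ℝ)
  f : ∀ l, C((Fin (dt l) → ℝ) × ℝ, Fin (df l) → ℝ)
  g : ∀ l, C((Fin (ds l) → ℝ) × ℝ, Fin (dg l) → ℝ)
  p : ∀ l, C((Fin (ds l) → ℝ) × (Fin (df l) → ℝ), Fin (ds (l + 1)) → ℝ)
  q : ∀ l, C((Fin (dt l) → ℝ) × (Fin (dg l) → ℝ), Fin (dt (l + 1)) → ℝ)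
  r : C((Fin (ds L) → ℝ) × (Fin (dt L) → ℝ), ℝ)

namespace SubgraphGNN

/-- The features `(i ↦ s^l_{i j'}, j ↦ t^l_{j j'})` for the anchor `j'` after `l` layers. -/
noncomputable def feat (N : SubgraphGNN) (G : BipartiteGraph) (j' : Fin G.n) :
    (l : ℕ) → (Fin G.m → Fin (N.ds l) → ℝ) × (Fin G.n → Fin (N.dt l) → ℝ)
  | 0 => (fun i => N.p0 (G.FV i, G.FW j'),
      fun j => N.q0 (G.FW j, G.FW j', if j = j' then 1 else 0))
  | l + 1 =>
      (fun i => N.p l ((N.feat G j' l).1 i,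
        ∑ j ∈ G.nbrW i, N.f l ((N.feat G j' l).2 j, G.A i j)),
      fun j => N.q l ((N.feat G j' l).2 j,
        ∑ i ∈ G.nbrV j, N.g l ((N.feat G j' l).1 i, G.A i j)))

/-- The final feature `y_{j'}` of the variable node `j'`. -/
noncomputable def output (N : SubgraphGNN) (G : BipartiteGraph) (j' : Fin G.n) : ℝ :=
  N.r (∑ i, (N.feat G j' N.L).1 i, ∑ j, (N.feat G j' N.L).2 j)

end SubgraphGNN

/-! Colour refinement determines the score, and on finitely many anchored graphs a subgraph GNN
reproduces colour refinement exactly. Refinement run jointly on all of them stabilises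
(`exists_isStableAt`). If two anchored instances then have equal colour counts, averaging over
colour classes gives stochastic matrices intertwining their constraint matrices, in both directions
(`MILP.nonempty_folding_of_coloring`). These maps preserve feasibility and objective and do not
increase the norm; they also carry the anchor's value across, since each anchor is alone in its
class within its instance. So the least-norm solutions agree at the anchors, the branched optima
agree, and the scores are equal (`MILP.Folding.score_eq`).

Hence the score is a function of the sums of final colours. Tietze extension realises this function
and every update (`exists_subgraphGNN_output_eq`), with zero error. -/

/-- A row-stochastic pair of matrices `(S, R)` transporting the linear program of `P` to that of
`Q` so that the value of the variable `j₀` becomes the value of the variable `k₀`. -/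
structure MILP.Folding (P Q : MILP) (j₀ : Fin P.n) (k₀ : Fin Q.n) where
  S : Fin Q.n → Fin P.n → ℝ
  R : Fin Q.m → Fin P.m → ℝ
  S_nonneg : ∀ k j, 0 ≤ S k j
  R_nonneg : ∀ i' i, 0 ≤ R i' i
  S_row : ∀ k, ∑ j, S k j = 1
  S_col : ∀ j, ∑ k, S k j = 1
  R_row : ∀ i', ∑ i, R i' i = 1
  intertwine : ∀ i' j, ∑ k, Q.A i' k * S k j = ∑ i, R i' i * P.A i j
  b_eq : ∀ i' i, R i' i ≠ 0 → P.b i = Q.b i'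
  c_eq : ∀ k j, S k j ≠ 0 → P.c j = Q.c k
  l_eq : ∀ k j, S k j ≠ 0 → P.l j = Q.l k
  u_eq : ∀ k j, S k j ≠ 0 → P.u j = Q.u k
  anchor : ∀ j, S k₀ j ≠ 0 → j = j₀

/-! ### Transport of LP solutions and scores along foldings. -/

namespace MILP

theorem convex_setOf_coe_mem_Icc (a b : EReal) :
    Convex ℝ {t : ℝ | a ≤ (t : EReal) ∧ (t : EReal) ≤ b} := by
  apply Set.OrdConnected.convex
  refine ⟨fun x hx y hy z hz => ⟨hx.1.trans ?_, le_trans ?_ hy.2⟩⟩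
  · exact_mod_cast hz.1
  · exact_mod_cast hz.2

theorem convex_lpFeasible (P : MILP) : Convex ℝ P.lpFeasible := by
  rintro x ⟨hx, hx'⟩ y ⟨hy, hy'⟩ s t hs ht hst
  refine ⟨fun i => ?_, fun j => convex_setOf_coe_mem_Icc _ _ (hx' j) (hy' j) hs ht hst⟩
  calc ∑ j, P.A i j * (s • x + t • y) j
      = s * ∑ j, P.A i j * x j + t * ∑ j, P.A i j * y j := by
        simp only [Finset.mul_sum, ← Finset.sum_add_distrib, Pi.add_apply, Pi.smul_apply,
          smul_eq_mul]
        exact Finset.sum_congr rfl fun j _ => by ring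
    _ ≤ s * P.b i + t * P.b i := by gcongr <;> simp only [hx, hy]
    _ = P.b i := by rw [← add_mul, hst, one_mul]

/-- The midpoint of two solutions is again optimal, and by the parallelogram identity it has smaller
norm unless they coincide. -/
theorem IsLPSolution.unique {P : MILP} {x y : Fin P.n → ℝ} (hx : P.IsLPSolution x)
    (hy : P.IsLPSolution y) : x = y := by
  set z : Fin P.n → ℝ := (1 / 2 : ℝ) • x + (1 / 2 : ℝ) • y with hz
  have hzj : ∀ j, z j = (x j + y j) / 2 := fun j => by simp [hz]; ring
  have hobj : P.obj z = (P.obj x + P.obj y) / 2 := by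
    simp only [obj, hzj, ← Finset.sum_add_distrib, Finset.sum_div]
    exact Finset.sum_congr rfl fun j _ => by ring
  have hxy : P.obj x = P.obj y := le_antisymm (hx.1.2 y hy.1.1) (hy.1.2 x hx.1.1)
  have hzopt : P.IsOptimal z := by
    refine ⟨P.convex_lpFeasible hx.1.1 hy.1.1 (by norm_num) (by norm_num) (by norm_num),
      fun w hw => ?_⟩
    rw [hobj, ← hxy, add_self_div_two]
    exact hx.1.2 w hw
  have hsum : ∑ j, z j ^ 2 =
      (∑ j, x j ^ 2 + ∑ j, y j ^ 2) / 2 - (∑ j, (x j - y j) ^ 2) / 4 := by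
    simp only [hzj, ← Finset.sum_add_distrib, Finset.sum_div, ← Finset.sum_sub_distrib]
    exact Finset.sum_congr rfl fun j _ => by ring
  have h0 : ∑ j, (x j - y j) ^ 2 = 0 := by
    apply le_antisymm _ (Finset.sum_nonneg fun j _ => sq_nonneg _)
    linarith [hx.2 z hzopt, hy.2 z hzopt]
  funext j
  have := (Finset.sum_eq_zero_iff_of_nonneg fun j _ => sq_nonneg (x j - y j)).1 h0 j
    (Finset.mem_univ j)
  exact sub_eq_zero.1 (pow_eq_zero_iff two_ne_zero |>.1 this)

namespace Folding

variable {P Q : MILP} {j₀ : Fin P.n} {k₀ : Fin Q.n}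

/-- The image in `Q` of a point of `P`. -/
def map (F : P.Folding Q j₀ k₀) (x : Fin P.n → ℝ) : Fin Q.n → ℝ := fun k => ∑ j, F.S k j * x j

theorem map_feasible (F : P.Folding Q j₀ k₀) {x : Fin P.n → ℝ} (hx : x ∈ P.lpFeasible) :
    F.map x ∈ Q.lpFeasible := by
  refine ⟨fun i' => ?_, fun k => ?_⟩
  · calc ∑ k, Q.A i' k * F.map x k = ∑ j, (∑ k, Q.A i' k * F.S k j) * x j := by
          simp only [map, Finset.mul_sum, Finset.sum_mul]
          rw [Finset.sum_comm]
          simp only [mul_assoc]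
      _ = ∑ i, F.R i' i * ∑ j, P.A i j * x j := by
          simp only [F.intertwine, Finset.mul_sum, Finset.sum_mul]
          rw [Finset.sum_comm]
          simp only [mul_assoc]
      _ ≤ ∑ i, F.R i' i * Q.b i' := by
          refine Finset.sum_le_sum fun i _ => ?_
          by_cases h : F.R i' i = 0
          · simp [h]
          · rw [← F.b_eq i' i h]
            exact mul_le_mul_of_nonneg_left (hx.1 i) (F.R_nonneg i' i)
      _ = Q.b i' := by rw [← Finset.sum_mul, F.R_row, one_mul]
  -- Row `k` of `S` averages only coordinates whose bounds are those of `k`.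
  · have h := (convex_setOf_coe_mem_Icc (Q.l k) (Q.u k)).finsum_mem (w := F.S k) (z := x)
      (F.S_nonneg k) (by rw [finsum_eq_sum_of_fintype, F.S_row])
      (fun j hj => by
        show Q.l k ≤ _ ∧ _ ≤ Q.u k
        rw [← F.l_eq k j hj, ← F.u_eq k j hj]
        exact hx.2 j)
    rw [finsum_eq_sum_of_fintype] at h
    exact h

theorem obj_map (F : P.Folding Q j₀ k₀) (x : Fin P.n → ℝ) : Q.obj (F.map x) = P.obj x := by
  simp only [obj, map, Finset.mul_sum]
  rw [Finset.sum_comm]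
  refine Finset.sum_congr rfl fun j _ => ?_
  calc ∑ k, Q.c k * (F.S k j * x j) = ∑ k, F.S k j * (P.c j * x j) := by
        refine Finset.sum_congr rfl fun k _ => ?_
        by_cases h : F.S k j = 0
        · simp [h]
        · rw [F.c_eq k j h]; ring
    _ = P.c j * x j := by rw [← Finset.sum_mul, F.S_col, one_mul]

/-- Jensen along the rows of `S`, then unit column sums. This is what makes the least-norm choice
compatible with foldings. -/
theorem sum_sq_map_le (F : P.Folding Q j₀ k₀) (x : Fin P.n → ℝ) :
    ∑ k, F.map x k ^ 2 ≤ ∑ j, x j ^ 2 :=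
  calc ∑ k, F.map x k ^ 2 ≤ ∑ k, ∑ j, F.S k j * x j ^ 2 :=
        Finset.sum_le_sum fun k _ => Real.pow_arith_mean_le_arith_mean_pow_of_even _ _ _
          (fun j _ => F.S_nonneg k j) (F.S_row k) even_two
    _ = ∑ j, x j ^ 2 := by
        rw [Finset.sum_comm]
        simp only [← Finset.sum_mul, F.S_col, one_mul]

theorem map_anchor (F : P.Folding Q j₀ k₀) (x : Fin P.n → ℝ) : F.map x k₀ = x j₀ :=
  calc ∑ j, F.S k₀ j * x j = ∑ j, F.S k₀ j * x j₀ := by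
        refine Finset.sum_congr rfl fun j _ => ?_
        by_cases h : F.S k₀ j = 0
        · simp [h]
        · rw [F.anchor j h]
    _ = x j₀ := by rw [← Finset.sum_mul, F.S_row, one_mul]

/-- The predicate may be any condition on the anchor's value, which covers both branches and the
plain relaxation. -/
theorem optValue_le (F : P.Folding Q j₀ k₀) (p : ℝ → Prop) :
    Q.optValue {z | z ∈ Q.lpFeasible ∧ p (z k₀)} ≤
      P.optValue {z | z ∈ P.lpFeasible ∧ p (z j₀)} := by
  refine le_iInf₂ fun z hz => ?_
  rw [← F.obj_map z]
  exact iInf₂_le (F.map z) ⟨F.map_feasible hz.1, by rw [F.map_anchor]; exact hz.2⟩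

theorem optValue_eq (F : P.Folding Q j₀ k₀) (F' : Q.Folding P k₀ j₀) (p : ℝ → Prop) :
    P.optValue {z | z ∈ P.lpFeasible ∧ p (z j₀)} =
      Q.optValue {z | z ∈ Q.lpFeasible ∧ p (z k₀)} :=
  le_antisymm (F'.optValue_le p) (F.optValue_le p)

theorem map_isOptimal (F : P.Folding Q j₀ k₀) (F' : Q.Folding P k₀ j₀) {x : Fin P.n → ℝ}
    (hx : P.IsOptimal x) : Q.IsOptimal (F.map x) := by
  refine ⟨F.map_feasible hx.1, fun y hy => ?_⟩
  rw [F.obj_map, ← F'.obj_map]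
  exact hx.2 _ (F'.map_feasible hy)

theorem map_isLPSolution (F : P.Folding Q j₀ k₀) (F' : Q.Folding P k₀ j₀) {x : Fin P.n → ℝ}
    (hx : P.IsLPSolution x) : Q.IsLPSolution (F.map x) :=
  ⟨F.map_isOptimal F' hx.1, fun y hy => (F.sum_sq_map_le x).trans
    ((hx.2 _ (F'.map_isOptimal F hy)).trans (F'.sum_sq_map_le y))⟩

theorem score_eq (F : P.Folding Q j₀ k₀) (F' : Q.Folding P k₀ j₀) (f : EReal → EReal → EReal)
    {x : Fin P.n → ℝ} {y : Fin Q.n → ℝ} (hx : P.IsLPSolution x) (hy : Q.IsLPSolution y) :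
    P.score f x j₀ = Q.score f y k₀ := by
  have hxy : y k₀ = x j₀ := by
    rw [hy.unique (F.map_isLPSolution F' hx), F.map_anchor]
  have hopt : P.optValue P.lpFeasible = Q.optValue Q.lpFeasible := by
    simpa using F.optValue_eq F' fun _ => True
  have h₁ := F.optValue_eq F' fun t => (⌈x j₀⌉ : ℝ) ≤ t
  have h₂ := F.optValue_eq F' fun t => t ≤ (⌊x j₀⌋ : ℝ)
  simp only [score, deltaPlus, deltaMinus, hxy, h₁, h₂, hopt]

end Folding

/-! ### Foldings from stable colourings. -/

/-- `S` and `R` average uniformly over the class of the same colour. Intertwining is a double count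
of the total weight of `Q` between a constraint class and a variable class. -/
theorem nonempty_folding_of_coloring {P Q : MILP} {j₀ : Fin P.n} {k₀ : Fin Q.n} {α β : Type*}
    [DecidableEq α] [DecidableEq β] (γ : Fin P.m → α) (γ' : Fin Q.m → α) (κ : Fin P.n → β) (κ' : Fin Q.n → β)
    (cardV : ∀ a, ∑ i, (if γ i = a then (1 : ℝ) else 0) = ∑ i, if γ' i = a then 1 else 0)
    (cardW : ∀ a, ∑ j, (if κ j = a then (1 : ℝ) else 0) = ∑ k, if κ' k = a then 1 else 0)
    (hb : ∀ i i', γ i = γ' i' → P.b i = Q.b i')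
    (hw : ∀ j k, κ j = κ' k → P.c j = Q.c k ∧ P.l j = Q.l k ∧ P.u j = Q.u k)
    (row : ∀ i i', γ' i = γ' i' → ∀ a,
      ∑ k, (if κ' k = a then Q.A i k else 0) = ∑ k, if κ' k = a then Q.A i' k else 0)
    (col : ∀ j k, κ j = κ' k → ∀ a,
      ∑ i, (if γ i = a then P.A i j else 0) = ∑ i, if γ' i = a then Q.A i k else 0)
    (hanchor : ∀ j, κ j = κ' k₀ → j = j₀) : Nonempty (P.Folding Q j₀ k₀) := by
  set NV : α → ℝ := fun a => ∑ i, if γ' i = a then 1 else 0 with hNV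
  set NW : β → ℝ := fun a => ∑ k, if κ' k = a then 1 else 0 with hNW
  have posV : ∀ i, NV (γ' i) ≠ 0 := fun i => by
    refine (Finset.sum_pos' (fun i' _ => by positivity) ⟨i, Finset.mem_univ i, by simp⟩).ne'
  have posW : ∀ k, NW (κ' k) ≠ 0 := fun k => by
    refine (Finset.sum_pos' (fun i' _ => by positivity) ⟨k, Finset.mem_univ k, by simp⟩).ne'
  have posW' : ∀ j, NW (κ j) ≠ 0 := fun j => by
    rw [hNW]
    beta_reduce
    rw [← cardW]
    refine (Finset.sum_pos' (fun i' _ => by positivity) ⟨j, Finset.mem_univ j, by simp⟩).ne'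
  have eq_of_ne {p : Prop} [Decidable p] {c : ℝ} (h : (if p then c else 0) ≠ 0) : p := by
    by_contra hp
    exact h (if_neg hp)
  refine ⟨{
    S := fun k j => if κ j = κ' k then (NW (κ j))⁻¹ else 0
    R := fun i' i => if γ i = γ' i' then (NV (γ' i'))⁻¹ else 0
    S_nonneg := fun k j => by positivity
    R_nonneg := fun i' i => by positivity
    S_row := fun k => ?_
    S_col := fun j => ?_
    R_row := fun i' => ?_
    intertwine := fun i' j => ?_
    b_eq := fun i' i h => hb i i' (eq_of_ne h)
    c_eq := fun k j h => (hw j k (eq_of_ne h)).1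
    l_eq := fun k j h => (hw j k (eq_of_ne h)).2.1
    u_eq := fun k j h => (hw j k (eq_of_ne h)).2.2
    anchor := fun j h => hanchor j (eq_of_ne h) }⟩
  · calc ∑ j, (if κ j = κ' k then (NW (κ j))⁻¹ else 0)
        = ∑ j, (if κ j = κ' k then (1 : ℝ) else 0) * (NW (κ' k))⁻¹ := by
          refine Finset.sum_congr rfl fun j _ => ?_
          split_ifs with h <;> simp [h]
      _ = 1 := by rw [← Finset.sum_mul, cardW]; exact mul_inv_cancel₀ (posW k)
  · calc ∑ k, (if κ j = κ' k then (NW (κ j))⁻¹ else 0)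
        = ∑ k, (if κ' k = κ j then (1 : ℝ) else 0) * (NW (κ j))⁻¹ := by
          refine Finset.sum_congr rfl fun k _ => ?_
          simp only [eq_comm (a := κ j), ite_mul, one_mul, zero_mul]
      _ = 1 := by rw [← Finset.sum_mul]; exact mul_inv_cancel₀ (posW' j)
  · calc ∑ i, (if γ i = γ' i' then (NV (γ' i'))⁻¹ else 0)
        = ∑ i, (if γ i = γ' i' then (1 : ℝ) else 0) * (NV (γ' i'))⁻¹ := by
          simp only [ite_mul, one_mul, zero_mul]
      _ = 1 := by rw [← Finset.sum_mul, cardV]; exact mul_inv_cancel₀ (posV i')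
  · have hL : ∑ k, Q.A i' k * (if κ j = κ' k then (NW (κ j))⁻¹ else 0) =
        (∑ k, if κ' k = κ j then Q.A i' k else 0) * (NW (κ j))⁻¹ := by
      simp only [eq_comm (a := κ j), Finset.sum_mul, mul_ite, ite_mul, zero_mul, mul_zero]
    have hR : ∑ i, (if γ i = γ' i' then (NV (γ' i'))⁻¹ else 0) * P.A i j =
        (∑ i, if γ i = γ' i' then P.A i j else 0) * (NV (γ' i'))⁻¹ := by
      simp only [Finset.sum_mul, ite_mul, zero_mul, mul_comm (P.A _ j)]
    -- Counted by rows: all rows in the class have the same sum.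
    have h₁ : ∑ i, ∑ k, (if γ' i = γ' i' then (if κ' k = κ j then Q.A i k else 0) else 0) =
        NV (γ' i') * ∑ k, if κ' k = κ j then Q.A i' k else 0 := by
      rw [hNV, Finset.sum_mul]
      refine Finset.sum_congr rfl fun i _ => ?_
      by_cases h : γ' i = γ' i'
      · simp only [h, if_true, one_mul, row i i' h]
      · simp [h]
    -- Counted by columns, whose sums in `Q` equal that of column `j` of `P`.
    have h₂ : ∑ i, ∑ k, (if γ' i = γ' i' then (if κ' k = κ j then Q.A i k else 0) else 0) =
        NW (κ j) * ∑ i, if γ i = γ' i' then P.A i j else 0 := by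
      rw [hNW, Finset.sum_mul, Finset.sum_comm]
      refine Finset.sum_congr rfl fun k _ => ?_
      by_cases h : κ' k = κ j
      · simp only [h, if_true, one_mul, col j k h.symm]
      · simp [h]
    rw [hL, hR, ← div_eq_mul_inv, ← div_eq_mul_inv, div_eq_div_iff (posW' j) (posV i'),
      mul_comm, ← h₁, h₂, mul_comm]

end MILP

-- Interpolation on finite sets and indicator vectors.

-- The range of `φ` is finite, so closed and discrete; Tietze extends the induced function.
universe u v in
theorem exists_continuousMap_apply_eq {U : Type*} {X : Type u} {Y : Type v} [Finite U]
    [TopologicalSpace X] [T4Space X] [TopologicalSpace Y] [TietzeExtension.{u, v} Y] (φ : U → X) (h : U → Y)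
    (hφ : ∀ u v, φ u = φ v → h u = h v) : ∃ F : C(X, Y), ∀ u, F (φ u) = h u := by
  have hfin : (Set.range φ).Finite := Set.finite_range φ
  have : Finite (Set.range φ) := hfin
  obtain ⟨F, hF⟩ := ContinuousMap.exists_restrict_eq hfin.isClosed
    (⟨fun x => h x.2.choose, continuous_of_discreteTopology⟩ : C(Set.range φ, Y))
  refine ⟨F, fun u => ?_⟩
  have := DFunLike.congr_fun hF ⟨φ u, u, rfl⟩
  exact this.trans (hφ _ _ (Exists.choose_spec (⟨u, rfl⟩ : ∃ v, φ v = φ u)))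

open Classical in
/-- The indicator vector of the fibre of `φ` through `u`. -/
noncomputable def fiberVector {U X : Type*} [Fintype U] (φ : U → X) (u : U) :
    Fin (Fintype.card U) → ℝ :=
  fun k => if φ u = φ ((Fintype.equivFin U).symm k) then 1 else 0

theorem fiberVector_inj {U X : Type*} [Fintype U] {φ : U → X} {u v : U} :
    fiberVector φ u = fiberVector φ v ↔ φ u = φ v := by
  refine ⟨fun h => ?_, fun h => by unfold fiberVector; rw [h]⟩
  by_contra hne
  simpa [fiberVector, hne] using congrFun h (Fintype.equivFin U v)

open Classical in
theorem fiberVector_apply_equivFin {U X : Type*} [Fintype U] (φ : U → X) (u v : U) :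
    fiberVector φ u (Fintype.equivFin U v) =
      if fiberVector φ u = fiberVector φ v then 1 else 0 := by
  simp only [fiberVector_inj]
  simp [fiberVector]

/-! ### Colour refinement and its simulation by a GNN. -/

section Refinement

variable {ι : Type} [Fintype ι] (G : ι → BipartiteGraph) (a : ∀ i, Fin (G i).n)

/-- The constraint nodes of a family of graphs. -/
abbrev VNode : Type := Σ i, Fin (G i).m

/-- The variable nodes of a family of graphs. -/
abbrev WNode : Type := Σ i, Fin (G i).n

/-- Colour refinement on a family of graphs with anchors; the colour of a node is the indicator
vector of the set of all nodes of that colour. -/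
noncomputable def color : ℕ → (VNode G → Fin (Fintype.card (VNode G)) → ℝ) ×
    (WNode G → Fin (Fintype.card (WNode G)) → ℝ)
  | 0 => (fiberVector fun v => ((G v.1).FV v.2, (G v.1).FW (a v.1)),
      fiberVector fun w => ((G w.1).FW w.2, (G w.1).FW (a w.1),
        if w.2 = a w.1 then (1 : ℝ) else 0))
  | l + 1 => (fiberVector fun v => ((color l).1 v, ∑ j, (G v.1).A v.2 j • (color l).2 ⟨v.1, j⟩),
      fiberVector fun w => ((color l).2 w, ∑ i, (G w.1).A i w.2 • (color l).1 ⟨w.1, i⟩))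

theorem color_fst_zero_inj {u v : VNode G} : (color G a 0).1 u = (color G a 0).1 v ↔
    ((G u.1).FV u.2, (G u.1).FW (a u.1)) = ((G v.1).FV v.2, (G v.1).FW (a v.1)) := by
  simp only [color, fiberVector_inj]

theorem color_snd_zero_inj {u v : WNode G} : (color G a 0).2 u = (color G a 0).2 v ↔
    ((G u.1).FW u.2, (G u.1).FW (a u.1), if u.2 = a u.1 then (1 : ℝ) else 0) =
      ((G v.1).FW v.2, (G v.1).FW (a v.1), if v.2 = a v.1 then (1 : ℝ) else 0) := by
  simp only [color, fiberVector_inj]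

theorem color_fst_succ_inj {l : ℕ} {u v : VNode G} :
    (color G a (l + 1)).1 u = (color G a (l + 1)).1 v ↔
      ((color G a l).1 u, ∑ j, (G u.1).A u.2 j • (color G a l).2 ⟨u.1, j⟩) =
        ((color G a l).1 v, ∑ j, (G v.1).A v.2 j • (color G a l).2 ⟨v.1, j⟩) := by
  simp only [color, fiberVector_inj]

theorem color_snd_succ_inj {l : ℕ} {u v : WNode G} :
    (color G a (l + 1)).2 u = (color G a (l + 1)).2 v ↔
      ((color G a l).2 u, ∑ i, (G u.1).A i u.2 • (color G a l).1 ⟨u.1, i⟩) =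
        ((color G a l).2 v, ∑ i, (G v.1).A i v.2 • (color G a l).1 ⟨v.1, i⟩) := by
  simp only [color, fiberVector_inj]

theorem color_fst_apply (l : ℕ) (u v : VNode G) :
    (color G a l).1 u (Fintype.equivFin _ v) =
      if (color G a l).1 u = (color G a l).1 v then 1 else 0 := by
  cases l <;> rw [color] <;> convert fiberVector_apply_equivFin _ u v

theorem color_snd_apply (l : ℕ) (u v : WNode G) :
    (color G a l).2 u (Fintype.equivFin _ v) =
      if (color G a l).2 u = (color G a l).2 v then 1 else 0 := by
  cases l <;> rw [color] <;> convert fiberVector_apply_equivFin _ u v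

theorem color_fst_of_succ {l : ℕ} {u v : VNode G}
    (h : (color G a (l + 1)).1 u = (color G a (l + 1)).1 v) :
    (color G a l).1 u = (color G a l).1 v :=
  (Prod.ext_iff.1 ((color_fst_succ_inj G a).1 h)).1

theorem color_snd_of_succ {l : ℕ} {u v : WNode G}
    (h : (color G a (l + 1)).2 u = (color G a (l + 1)).2 v) :
    (color G a l).2 u = (color G a l).2 v :=
  (Prod.ext_iff.1 ((color_snd_succ_inj G a).1 h)).1

theorem FV_eq_of_color_eq {l : ℕ} {u v : VNode G} (h : (color G a l).1 u = (color G a l).1 v) :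
    (G u.1).FV u.2 = (G v.1).FV v.2 := by
  induction l with
  | zero => exact (Prod.ext_iff.1 ((color_fst_zero_inj G a).1 h)).1
  | succ l ih => exact ih (color_fst_of_succ G a h)

theorem FW_eq_of_color_eq {l : ℕ} {u v : WNode G} (h : (color G a l).2 u = (color G a l).2 v) :
    (G u.1).FW u.2 = (G v.1).FW v.2 ∧ (u.2 = a u.1 ↔ v.2 = a v.1) := by
  induction l with
  | zero =>
    have h' := Prod.ext_iff.1 ((color_snd_zero_inj G a).1 h)
    refine ⟨h'.1, ?_⟩
    have h₂ := (Prod.ext_iff.1 h'.2).2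
    by_cases h₃ : u.2 = a u.1 <;> by_cases h₄ : v.2 = a v.1 <;> simp_all
  | succ l ih => exact ih (color_snd_of_succ G a h)

/-- No pair of nodes of the same colour is separated by a further step of colour refinement. -/
def IsStableAt (l : ℕ) : Prop :=
  (∀ u v, (color G a l).1 u = (color G a l).1 v →
    (color G a (l + 1)).1 u = (color G a (l + 1)).1 v) ∧
  ∀ u v, (color G a l).2 u = (color G a l).2 v →
    (color G a (l + 1)).2 u = (color G a (l + 1)).2 v

theorem exists_isStableAt : ∃ l, IsStableAt G a l := by
  let K : ℕ → Set (VNode G × VNode G) × Set (WNode G × WNode G) := fun l =>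
    ({z | (color G a l).1 z.1 = (color G a l).1 z.2},
      {z | (color G a l).2 z.1 = (color G a l).2 z.2})
  have hK : Antitone K := antitone_nat_of_succ_le fun l =>
    ⟨fun _ h => color_fst_of_succ G a h, fun _ h => color_snd_of_succ G a h⟩
  -- The same-colour relations decrease inside a finite lattice, so they become constant.
  obtain ⟨l, hl⟩ := WellFoundedGT.monotone_chain_condition
    (⟨fun l => OrderDual.toDual (K l), fun _ _ h => hK h⟩ :
      ℕ →o (Set (VNode G × VNode G) × Set (WNode G × WNode G))ᵒᵈ)
  have h : K l = K (l + 1) := hl (l + 1) (Nat.le_succ l)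
  obtain ⟨h₁, h₂⟩ := Prod.ext_iff.1 h
  exact ⟨l, fun u v huv => (Set.ext_iff.1 h₁ (u, v)).1 huv,
    fun u v huv => (Set.ext_iff.1 h₂ (u, v)).1 huv⟩

/-- Distinct colours are indicators of disjoint sets, so coordinate `v` of a combination of colours
reads off the total weight on the colour of `v`. -/
theorem sum_color_fst {l : ℕ} {i i' : ι} {x : Fin (G i).m → ℝ} {y : Fin (G i').m → ℝ}
    (h : ∑ k, x k • (color G a l).1 ⟨i, k⟩ = ∑ k, y k • (color G a l).1 ⟨i', k⟩)
    (t : Fin (Fintype.card (VNode G)) → ℝ) :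
    ∑ k, (if (color G a l).1 ⟨i, k⟩ = t then x k else 0) =
      ∑ k, if (color G a l).1 ⟨i', k⟩ = t then y k else 0 := by
  by_cases ht : ∃ v, (color G a l).1 v = t
  · obtain ⟨v, rfl⟩ := ht
    simpa [Finset.sum_apply, color_fst_apply] using congrFun h (Fintype.equivFin _ v)
  · push Not at ht
    simp [ht]

theorem sum_color_snd {l : ℕ} {i i' : ι} {x : Fin (G i).n → ℝ} {y : Fin (G i').n → ℝ}
    (h : ∑ k, x k • (color G a l).2 ⟨i, k⟩ = ∑ k, y k • (color G a l).2 ⟨i', k⟩)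
    (t : Fin (Fintype.card (WNode G)) → ℝ) :
    ∑ k, (if (color G a l).2 ⟨i, k⟩ = t then x k else 0) =
      ∑ k, if (color G a l).2 ⟨i', k⟩ = t then y k else 0 := by
  by_cases ht : ∃ v, (color G a l).2 v = t
  · obtain ⟨v, rfl⟩ := ht
    simpa [Finset.sum_apply, color_snd_apply] using congrFun h (Fintype.equivFin _ v)
  · push Not at ht
    simp [ht]

theorem BipartiteGraph.sum_nbrW {M : Type*} [AddCommMonoid M] [Module ℝ M] (G : BipartiteGraph)
    (i : Fin G.m) (x : Fin G.n → M) : ∑ j ∈ G.nbrW i, G.A i j • x j = ∑ j, G.A i j • x j := by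
  refine Finset.sum_subset (Finset.subset_univ _) fun j _ hj => ?_
  have : G.A i j = 0 := by simpa [nbrW] using hj
  rw [this, zero_smul]

theorem BipartiteGraph.sum_nbrV {M : Type*} [AddCommMonoid M] [Module ℝ M] (G : BipartiteGraph)
    (j : Fin G.n) (x : Fin G.m → M) : ∑ i ∈ G.nbrV j, G.A i j • x i = ∑ i, G.A i j • x i := by
  refine Finset.sum_subset (Finset.subset_univ _) fun i _ hi => ?_
  have : G.A i j = 0 := by simpa [nbrV] using hi
  rw [this, zero_smul]

theorem exists_subgraphGNN_output_eq (L : ℕ) (y : ι → ℝ)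
    (hy : ∀ i i', ∑ k, (color G a L).1 ⟨i, k⟩ = ∑ k, (color G a L).1 ⟨i', k⟩ →
      ∑ k, (color G a L).2 ⟨i, k⟩ = ∑ k, (color G a L).2 ⟨i', k⟩ → y i = y i') :
    ∃ N : SubgraphGNN, ∀ i, N.output (G i) (a i) = y i := by
  obtain ⟨p0, hp0⟩ := exists_continuousMap_apply_eq
    (fun v : VNode G => ((G v.1).FV v.2, (G v.1).FW (a v.1))) (color G a 0).1
    fun u v h => (color_fst_zero_inj G a).2 h
  obtain ⟨q0, hq0⟩ := exists_continuousMap_apply_eq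
    (fun w : WNode G => ((G w.1).FW w.2, (G w.1).FW (a w.1),
      if w.2 = a w.1 then (1 : ℝ) else 0)) (color G a 0).2
    fun u v h => (color_snd_zero_inj G a).2 h
  choose p hp using fun l => exists_continuousMap_apply_eq
    (fun v : VNode G => ((color G a l).1 v, ∑ j, (G v.1).A v.2 j • (color G a l).2 ⟨v.1, j⟩))
    (color G a (l + 1)).1 fun u v h => (color_fst_succ_inj G a).2 h
  choose q hq using fun l => exists_continuousMap_apply_eq
    (fun w : WNode G => ((color G a l).2 w, ∑ i, (G w.1).A i w.2 • (color G a l).1 ⟨w.1, i⟩))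
    (color G a (l + 1)).2 fun u v h => (color_snd_succ_inj G a).2 h
  obtain ⟨r, hr⟩ := exists_continuousMap_apply_eq
    (fun i => (∑ k, (color G a L).1 ⟨i, k⟩, ∑ k, (color G a L).2 ⟨i, k⟩)) y
    fun i i' h => hy i i' (Prod.ext_iff.1 h).1 (Prod.ext_iff.1 h).2
  let N : SubgraphGNN :=
    { L := L
      ds := fun _ => Fintype.card (VNode G)
      dt := fun _ => Fintype.card (WNode G)
      df := fun _ => Fintype.card (WNode G)
      dg := fun _ => Fintype.card (VNode G)
      p0 := p0
      q0 := q0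
      -- Messages are linear in the edge weight, so non-edges may be added to the sum freely.
      f := fun _ => ⟨fun z => z.2 • z.1, by fun_prop⟩
      g := fun _ => ⟨fun z => z.2 • z.1, by fun_prop⟩
      p := p
      q := q
      r := r }
  have hfeat : ∀ i l, N.feat (G i) (a i) l =
      (fun k => (color G a l).1 ⟨i, k⟩, fun k => (color G a l).2 ⟨i, k⟩) := by
    intro i l
    induction l with
    | zero => exact Prod.ext (funext fun k => hp0 ⟨i, k⟩) (funext fun k => hq0 ⟨i, k⟩)
    | succ l ih =>
      rw [SubgraphGNN.feat, ih]
      refine Prod.ext (funext fun k => ?_) (funext fun k => ?_)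
      · refine Eq.trans ?_ (hp l ⟨i, k⟩)
        exact congrArg (fun z => p l ((color G a l).1 ⟨i, k⟩, z))
          ((G i).sum_nbrW k fun j => (color G a l).2 ⟨i, j⟩)
      · refine Eq.trans ?_ (hq l ⟨i, k⟩)
        exact congrArg (fun z => q l ((color G a l).2 ⟨i, k⟩, z))
          ((G i).sum_nbrV k fun j => (color G a l).1 ⟨i, j⟩)
  refine ⟨N, fun i => ?_⟩
  rw [SubgraphGNN.output, hfeat]
  exact hr i

theorem nonempty_folding_of_isStableAt (P : ι → MILP) (a : ∀ i, Fin (P i).n) {L : ℕ}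
    (hL : IsStableAt (fun i => (P i).graph) a L) {i i' : ι}
    (hV : ∑ k, (color (fun i => (P i).graph) a L).1 ⟨i, k⟩ =
      ∑ k, (color (fun i => (P i).graph) a L).1 ⟨i', k⟩)
    (hW : ∑ k, (color (fun i => (P i).graph) a L).2 ⟨i, k⟩ =
      ∑ k, (color (fun i => (P i).graph) a L).2 ⟨i', k⟩) :
    Nonempty ((P i).Folding (P i') (a i) (a i')) := by
  let G : ι → BipartiteGraph := fun i => (P i).graph
  -- Unit weights turn sums of colours into class sizes.
  have cardW := sum_color_snd G a (l := L) (i := i) (i' := i') (x := fun _ => 1)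
    (y := fun _ => 1) (by simpa using hW)
  have cardV := sum_color_fst G a (l := L) (i := i) (i' := i') (x := fun _ => 1)
    (y := fun _ => 1) (by simpa using hV)
  refine MILP.nonempty_folding_of_coloring
    (fun k => (color G a L).1 ⟨i, k⟩) (fun k => (color G a L).1 ⟨i', k⟩)
    (fun k => (color G a L).2 ⟨i, k⟩) (fun k => (color G a L).2 ⟨i', k⟩)
    cardV cardW
    (fun j k h => FV_eq_of_color_eq G a h) (fun j k h => ?_) (fun j k h => ?_) (fun j k h => ?_)
    (fun j h => (FW_eq_of_color_eq G a h).2.2 rfl)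
  · have h' : (G i).FW j = (G i').FW k := (FW_eq_of_color_eq G a h).1
    simp only [G, MILP.graph, Prod.mk.injEq] at h'
    exact ⟨h'.1, h'.2.1, h'.2.2.1⟩
  · exact sum_color_snd G a (Prod.ext_iff.1 ((color_fst_succ_inj G a).1 (hL.1 _ _ h))).2
  · exact sum_color_fst G a (Prod.ext_iff.1 ((color_snd_succ_inj G a).1 (hL.2 _ _ h))).2

end Refinement

/-! ### The main theorem. -/

theorem mainTheorem1 (D : Set MILP) (hD : D.Finite) (f : EReal → EReal → EReal)
    (hf : ContinuousOn (Function.uncurry f) (Set.Ico 0 ⊤ ×ˢ Set.Ico 0 ⊤))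
    (hscore : ∀ P ∈ D, ∀ x, P.IsLPSolution x → ∀ j, P.IsCandidate x j →
      P.score f x j ≠ ⊤ ∧ P.score f x j ≠ ⊥)
    (δ : ℝ) (hδ : 0 < δ) :
    ∃ N : SubgraphGNN, ∀ P ∈ D, ∀ x, P.IsLPSolution x → ∀ j, P.IsCandidate x j →
      |N.output P.graph j - (P.score f x j).toReal| < δ := by
  classical
  have : Fintype D := hD.fintype
  -- Every variable of a solvable instance serves as an anchor, candidate or not; the LP solution is
  -- needed to define the target value.
  let ι : Type := {z : Σ P : D, Fin P.1.n // ∃ x, z.1.1.IsLPSolution x}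
  let P : ι → MILP := fun i => i.1.1.1
  let a : ∀ i, Fin (P i).n := fun i => i.1.2
  choose x hx using fun i : ι => i.2
  obtain ⟨L, hL⟩ := exists_isStableAt (fun i => (P i).graph) a
  obtain ⟨N, hN⟩ := exists_subgraphGNN_output_eq (fun i => (P i).graph) a L
    (fun i => ((P i).score f (x i) (a i)).toReal) fun i i' hV hW => by
      obtain ⟨F⟩ := nonempty_folding_of_isStableAt P a hL hV hW
      obtain ⟨F'⟩ := nonempty_folding_of_isStableAt P a hL hV.symm hW.symm
      exact congrArg EReal.toReal (F.score_eq F' f (hx i) (hx i'))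
  refine ⟨N, fun Q hQ z hz j _ => ?_⟩
  have h := hN ⟨⟨⟨Q, hQ⟩, j⟩, z, hz⟩
  rw [show N.output Q.graph j = _ from h, (hx ⟨⟨⟨Q, hQ⟩, j⟩, z, hz⟩).unique hz, sub_self, abs_zero]
  exact hδ
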